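/- Throughout, $\mathcal H$ is the complex upper half-plane and $q=e^{2\pi i\tau}$. For a Dirichlet character $\chi$ modulo $N>1$ with conductor $u$ put $$\eta_\chi(\tau)=\prod_{n=1}^{\infty}\prod_{a=1}^{u}\bigl(1-e^{2\pi i a/u}q^n\bigr)^{\overline{\chi}(an)}\qquad(\tau\in\mathcal H),$$ where complex powers are taken with the principal branch. Let $\Gamma\subset\mathrm{SL}_2(\mathbf Z)$ be a subgroup of finite index. A *generalized modular function* (of weight $0$) on $\Gamma$ with multiplier $\nu$, where $\nu:\Gamma\to\mathbf C^*$ is a character, is a holomorphic function $f$ on $\mathcal H$ with $f(\gamma\tau)=\nu(\gamma)f(\tau)$ for all $\gamma\in\Gamma$, $\tau\in\mathcal H$, that is meromorphic at the cusps of $\Gamma$: for every $\gamma\in\mathrm{SL}_2(\mathbf Z)$ there are an integer $h>0$ with $\gamma\left(\begin{smallmatrix}1&h\\0&1\end{smallmatrix}\right)\gamma^{-1}\in\Gamma$, a number $\kappa\in\mathbf C$ and a function $G$ meromorphic at $0$ such that $f(\gamma\tau)=e^{2\pi i\kappa\tau/h}\,G(e^{2\pi i\tau/h})$ for all $\tau$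 with sufficiently large imaginary part. A *(meromorphic) modular function* on $\Gamma$ is a meromorphic function on $\mathcal H$ that is invariant under $\Gamma$ and meromorphic at the cusps (the above expansions hold with $\kappa=0$). Such a function has a *cuspidal divisor* if it has no zeros and no poles in $\mathcal H$. A function $f$ on $\mathcal H$ is an *$\eta$-quotient* if there are an integer $M\ge1$ and complex numbers $c$ and $(a_t)_{t\mid M}$ such that $f(\tau)=c\prod_{t\mid M}\eta(t\tau)^{a_t}$ for all $\tau\in\mathcal H$ (principal branch), where $\eta(\tau)=q^{1/24}\prod_{n\ge1}(1-q^n)$, with $q^{1/24}=e^{2\pi i\tau/24}$. **Theorem.** Let $\left(\frac{\cdot}{3}\right)$ and $\left(\frac{\cdot}{5}\right)$ be the Legendre symbols modulo $3$ and $5$, and let $\psi$ be the nontrivial Dirichlet character modulo $4$. The products defining $\eta_{\left(\frac{\cdot}{3}\right)}$, $\eta_\psi$ and $\eta_{\left(\frac{\cdot}{5}\right)}$ converge on $\mathcal H$, and these functions are generalized modular functions on $\Gamma_0(9)$, $\Gamma_0(16)$ and $\Gamma_0(25)$ respectively. Their multipliers are unitary, with values in the twelfth roots of unity; they have a cuspidal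 divisor; and none of them is an $\eta$-quotient. Moreover, the twelfth powers of these functions are meromorphic modular functions on $\Gamma_0(9)$, $\Gamma_0(16)$ and $\Gamma_0(25)$ respectively, with a cuspidal divisor. -/

import Mathlib

open Complex UpperHalfPlane CongruenceSubgroup Filter
open scoped MatrixGroups

noncomputable section

namespace GenEta

instance fact_prime_five : Fact (Nat.Prime 5) := ⟨by norm_num⟩

/-- The Legendre symbol `(· / p)`, as a complex Dirichlet character modulo `p`. -/
def legendreChar (p : ℕ) [Fact p.Prime] : DirichletCharacter ℂ p :=
  (quadraticChar (ZMod p)).ringHomComp (Int.castRingHom ℂ)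

/-- The nontrivial Dirichlet character modulo `4`, with complex values. -/
def psiFour : DirichletCharacter ℂ 4 :=
  ZMod.χ₄.ringHomComp (Int.castRingHom ℂ)

/-- The `n`-th factor `∏_{a=1}^u (1 - ζ_u^a q^n)^{conj χ(a n)}` of the generalized eta product,
where `u` is the conductor of `χ`, `ζ_u = e^{2πi/u}`, `q = e^{2πiτ}`, and the complex power is
taken with the principal branch. -/
def genEtaFactor {N : ℕ} (χ : DirichletCharacter ℂ N) (n : ℕ) (τ : ℍ) : ℂ :=
  ∏ a ∈ Finset.Icc 1 χ.conductor,
    (1 - exp (2 * Real.pi * Complex.I / χ.conductor) ^ a * exp (2 * Real.pi * Complex.I * τ) ^ n) ^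
      (starRingEnd ℂ (χ ((a * n : ℕ) : ZMod N)))

/-- The generalized Dedekind eta function attached to a Dirichlet character `χ` modulo `N > 1`:
`η_χ(τ) = ∏_{n ≥ 1} ∏_{a=1}^u (1 - ζ_u^a q^n)^{conj χ(a n)}`. -/
def genEta {N : ℕ} (χ : DirichletCharacter ℂ N) (τ : ℍ) : ℂ :=
  ∏' n : ℕ, genEtaFactor χ (n + 1) τ

/-- A generalized modular function of weight `0` on `Γ` with multiplier `ν`: a holomorphic
function on the upper half-plane which transforms under `Γ` by the (not necessarily unitary)
character `ν`, and which at every cusp `γ ∞` has an expansion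
`f(γ τ) = e^{2πiκτ/h} · G(e^{2πiτ/h})` with `κ ∈ ℂ` and `G` a Laurent series with finite principal
part, i.e. `G` meromorphic at `0`. Here `h > 0` is such that `γ T^h γ⁻¹ ∈ Γ`. -/
structure IsGMF (Γ : Subgroup SL(2, ℤ)) (ν : Γ →* ℂˣ) (f : ℍ → ℂ) : Prop where
  holo : DifferentiableOn ℂ (fun z : ℂ => f (ofComplex z)) {z : ℂ | 0 < z.im}
  transform : ∀ (γ : Γ) (τ : ℍ), f ((γ : SL(2, ℤ)) • τ) = (ν γ : ℂ) * f τ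
  mero_cusps : ∀ γ : SL(2, ℤ), ∃ h : ℕ, 0 < h ∧ γ * ModularGroup.T ^ h * γ⁻¹ ∈ Γ ∧
    ∃ (κ : ℂ) (G : ℂ → ℂ), MeromorphicAt G 0 ∧
      ∀ᶠ τ : ℍ in atImInfty,
        f (γ • τ) = exp (2 * Real.pi * Complex.I * κ * τ / h) * G (Function.Periodic.qParam h τ)

/-- A meromorphic modular function (of weight `0`) on `Γ`: a meromorphic function on the upper
half-plane, invariant under `Γ`, and meromorphic at all cusps of `Γ`. -/
structure IsModularFunction (Γ : Subgroup SL(2, ℤ)) (f : ℍ → ℂ) : Prop where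
  mero : ∀ z : ℂ, 0 < z.im → MeromorphicAt (fun w : ℂ => f (ofComplex w)) z
  invariant : ∀ γ ∈ Γ, ∀ τ : ℍ, f (γ • τ) = f τ
  mero_cusps : ∀ γ : SL(2, ℤ), ∃ h : ℕ, 0 < h ∧ γ * ModularGroup.T ^ h * γ⁻¹ ∈ Γ ∧
    ∃ G : ℂ → ℂ, MeromorphicAt G 0 ∧
      ∀ᶠ τ : ℍ in atImInfty, f (γ • τ) = G (Function.Periodic.qParam h τ)

/-- The divisor of `f` is cuspidal: `f` has neither zeros nor poles in the upper half-plane. -/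
def HasCuspidalDivisor (f : ℍ → ℂ) : Prop :=
  ∀ z : ℂ, 0 < z.im → MeromorphicAt (fun w : ℂ => f (ofComplex w)) z ∧
    meromorphicOrderAt (fun w : ℂ => f (ofComplex w)) z = 0

/-- `f` is an `η`-quotient of level `M`: `f(τ) = c ∏_{t ∣ M} η(tτ)^{a_t}` with complex `c`, `a_t`,
where complex powers are taken with the principal branch. -/
def IsEtaQuotientOfLevel (M : ℕ) (f : ℍ → ℂ) : Prop :=
  ∃ (c : ℂ) (a : ℕ → ℂ), ∀ τ : ℍ,
    f τ = c * ∏ t ∈ M.divisors, ModularForm.eta ((t : ℂ) * (τ : ℂ)) ^ a t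

/-- `f` is an `η`-quotient (of some positive level). -/
def IsEtaQuotient (f : ℍ → ℂ) : Prop :=
  ∃ M : ℕ, 0 < M ∧ IsEtaQuotientOfLevel M f

/-- `f` is a generalized modular function on `Γ` whose multiplier is unitary and takes values in
the twelfth roots of unity. -/
def IsGMFWithTwelfthRootMultiplier (Γ : Subgroup SL(2, ℤ)) (f : ℍ → ℂ) : Prop :=
  ∃ ν : Γ →* ℂˣ, IsGMF Γ ν f ∧ ∀ γ : Γ, ‖(ν γ : ℂ)‖ = 1 ∧ ν γ ^ 12 = 1

end GenEta

end

/-!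
For a primitive quadratic character `χ` modulo `u`, rearranging the factors of `η_χ` over the
residues of `a n` shows that `η_χ(τ)` is a nonzero constant times the finite product
`∏ x, η(τ + x / u) ^ χ x` of translates of the Dedekind eta function (`TwistDatum.exists_genEta_eq`);
for `u = 3` this is `η(τ + 1/3) / η(τ + 2/3)`. The sum of the exponents is zero, so factors that do
not depend on `x` drop out. Everything else is read off from this product.

*Modularity.* The function `η ^ 12` has weight `6` for `SL(2, ℤ)`, with the sign character
of `SL(2, ℤ/2) ≅ S₃` as multiplier (`eta_smul_pow_twelve`). For `γ = (a, b; c, d)` in `Γ₀(u²)` the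
translate by `x / u` of `γ τ` is the image under `SL(2, ℤ)` of the translate of `τ` by `x d² / u`,
with the same automorphy factor for all `x`, and `χ (x d²) = χ x`. So the automorphy factors cancel.
In the three cases at hand all the signs agree, so they cancel too, and the twelfth power of the
product is `Γ₀(u²)`-invariant (`TwistDatum.etaTwist_smul_pow`). Since a continuous function on the
connected upper half-plane with values in a finite set is constant, the product itself transforms by
a character with values in the twelfth roots of unity (`exists_multiplier`).

*Cusps.* For any `γ` in `SL(2, ℤ)` the matrix `(u, x; 0, u) γ` is an element of `SL(2, ℤ)` times an
upper triangular matrix `(α, β; 0, δ)` with `α δ = u²`. Hence the product at `γ τ` is a constant times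
a product of powers of `η((α τ + β) / δ)`, each with an explicit expansion in `exp(2πiτ / 2u²)`
(`TwistDatum.exists_etaTwist_expansion`).

*Not an `η`-quotient.* On the imaginary axis `η` is positive, so the principal powers there have the
expected logarithmic derivative, a combination of `E₂(tτ)`. In the expansion of an `η`-quotient of
level `M`, the coefficients of `q ^ m` with `m` prime to `M` are a constant multiple of `σ₁(m)`; for the
product of translates they are `χ(m) σ₁(m)` times a fixed multiple of the Gauss sum, which is
not zero. By Dirichlet's theorem there is a prime `m` not dividing `M` with `χ(m) = -1`; comparing it
with `m = 1` gives a contradiction (`TwistDatum.not_isEtaQuotient`).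
-/

namespace GenEta

open ModularForm

/-! ### The twelfth power of the Dedekind eta function -/

/-- The exponent, as a polynomial in the entries of a matrix modulo `2`, of the sign character of
`SL(2, ℤ/2) ≅ S₃`. -/
def signParity (a b c d : ZMod 2) : ZMod 2 := b + c + b * c * (1 + a + d)

/-- The value `±1` of the nontrivial quadratic character of `SL(2, ℤ)` at the matrix with entries
`a b c d`. It is a function of four integers, so that it can be evaluated without building an
element of `SL(2, ℤ)`. -/
def etaSign (a b c d : ℤ) : ℂ := if signParity a b c d = 0 then 1 else -1

lemma signParity_mul : ∀ a b c d a' b' c' d' : ZMod 2,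
    a * d - b * c = 1 → a' * d' - b' * c' = 1 →
    signParity (a * a' + b * c') (a * b' + b * d') (c * a' + d * c') (c * b' + d * d') =
      signParity a b c d + signParity a' b' c' d' := by
  unfold signParity
  decide

lemma etaSign_sq (a b c d : ℤ) : etaSign a b c d ^ 2 = 1 := by
  unfold etaSign; split_ifs <;> norm_num

lemma etaSign_mul {a b c d a' b' c' d' : ℤ} (h : a * d - b * c = 1) (h' : a' * d' - b' * c' = 1) :
    etaSign (a * a' + b * c') (a * b' + b * d') (c * a' + d * c') (c * b' + d * d') =
      etaSign a b c d * etaSign a' b' c' d' := by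
  have key := signParity_mul a b c d a' b' c' d' (by exact_mod_cast congrArg (Int.cast) h)
    (by exact_mod_cast congrArg (Int.cast) h')
  unfold etaSign
  push_cast
  rw [key]
  generalize signParity (a : ZMod 2) b c d = x
  generalize signParity (a' : ZMod 2) b' c' d' = y
  have hx : x = 0 ∨ x = 1 := by revert x; decide
  have hy : y = 0 ∨ y = 1 := by revert y; decide
  have h2 : (1 : ZMod 2) + 1 = 0 := by decide
  rcases hx with rfl | rfl <;> rcases hy with rfl | rfl <;> simp [h2]

/-- The value of `etaSign` at an element of `SL(2, ℤ)`. -/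
def etaSignSL (γ : SL(2, ℤ)) : ℂ := etaSign (γ 0 0) (γ 0 1) (γ 1 0) (γ 1 1)

lemma etaSignSL_mul (γ δ : SL(2, ℤ)) : etaSignSL (γ * δ) = etaSignSL γ * etaSignSL δ := by
  have h := γ.det_coe
  have h' := δ.det_coe
  rw [Matrix.det_fin_two] at h h'
  unfold etaSignSL
  rw [← etaSign_mul h h']
  simp [Matrix.mul_apply, Fin.sum_univ_two]

lemma etaSignSL_one : etaSignSL 1 = 1 := by
  simp [etaSignSL, etaSign, signParity]

lemma eta_add_one_pow_twelve (z : ℂ) : η (z + 1) ^ 12 = - η z ^ 12 := by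
  have h1 : Function.Periodic.qParam 1 (z + 1) = Function.Periodic.qParam 1 z := by
    simp only [Function.Periodic.qParam, Complex.ofReal_one, div_one, mul_add, mul_one,
      Complex.exp_add, Complex.exp_two_pi_mul_I]
  have h2 : Function.Periodic.qParam 24 (z + 1) ^ 12 = - Function.Periodic.qParam 24 z ^ 12 := by
    simp only [Function.Periodic.qParam, ← Complex.exp_nat_mul]
    rw [show ((12 : ℕ) : ℂ) * (2 * Real.pi * Complex.I * (z + 1) / (24 : ℝ)) =
      (12 : ℕ) * (2 * Real.pi * Complex.I * z / (24 : ℝ)) + Real.pi * Complex.I by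
        push_cast; ring, Complex.exp_add,
      Complex.exp_pi_mul_I]
    ring
  simp only [ModularForm.eta, eta_q, h1, mul_pow, h2]
  ring

lemma eta_neg_inv_pow_twelve (τ : ℍ) : η (-(τ : ℂ)⁻¹) ^ 12 = -(τ : ℂ) ^ 6 * η τ ^ 12 := by
  have he : η (-(τ : ℂ)⁻¹) = (sqrt Complex.I)⁻¹ * (sqrt τ * η τ) := by
    simpa [neg_div] using eta_comp_eq_csqrt_I_inv τ.2
  have hs : ∀ {z : ℂ}, z ≠ 0 → sqrt z ^ 12 = z ^ 6 := fun {z} hz => by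
    rw [sqrt_eq_exp hz, ← exp_nat_mul]
    rw [show ((12 : ℕ) : ℂ) * (log z / 2) = (6 : ℕ) * log z by push_cast; ring, exp_nat_mul,
      exp_log hz]
  rw [he, mul_pow, mul_pow, inv_pow, hs I_ne_zero, hs τ.ne_zero]
  rw [show Complex.I ^ 6 = -1 by rw [show 6 = 2 * 3 by rfl, pow_mul, I_sq]; norm_num]
  ring

lemma denom_SL_mul (g h : SL(2, ℤ)) (τ : ℍ) :
    denom (↑(g * h) : GL (Fin 2) ℝ) τ = denom g ↑(h • τ) * denom h τ := by
  rw [map_mul, map_mul, denom_cocycle _ _ τ.im_ne_zero, ModularGroup.sl_moeb,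
    coe_smul_of_det_pos (by simp)]

/-- The function `η¹²` is modular of weight `6` for `SL(2, ℤ)`, with the sign character. -/
lemma eta_smul_pow_twelve (γ : SL(2, ℤ)) (τ : ℍ) :
    η (γ • τ : ℍ) ^ 12 = etaSignSL γ * denom γ τ ^ 6 * η τ ^ 12 := by
  have hγ : γ ∈ Subgroup.closure {ModularGroup.S, ModularGroup.T} := by
    simp [SpecialLinearGroup.SL2Z_generators]
  induction hγ using Subgroup.closure_induction generalizing τ with
  | one => simp [etaSignSL_one]
  | mem g hg =>
    rcases hg with rfl | rfl
    · rw [UpperHalfPlane.modular_S_smul]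
      have : etaSignSL ModularGroup.S = -1 := by
        simp [etaSignSL, etaSign, signParity, ModularGroup.S]
        decide
      rw [this, ModularGroup.denom_S, coe_mk, inv_neg, eta_neg_inv_pow_twelve]
      ring
    · have : etaSignSL ModularGroup.T = -1 := by
        simp [etaSignSL, etaSign, signParity, ModularGroup.T]
      rw [this, UpperHalfPlane.modular_T_smul, coe_vadd, add_comm]
      rw [ModularGroup.denom_apply]
      simp [ModularGroup.T, eta_add_one_pow_twelve]
  | mul g h _ _ ihg ihh =>
    rw [mul_smul, ihg, ihh, etaSignSL_mul]
    rw [denom_SL_mul]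
    ring
  | inv g _ ih =>
    have h1 := ih (g⁻¹ • τ)
    rw [smul_inv_smul] at h1
    have h2 : denom g ↑(g⁻¹ • τ) * denom (↑(g⁻¹) : GL (Fin 2) ℝ) τ = 1 := by
      rw [← denom_SL_mul, mul_inv_cancel]
      simp
    have h3 : etaSignSL g⁻¹ * etaSignSL g = 1 := by
      rw [← etaSignSL_mul, inv_mul_cancel, etaSignSL_one]
    have h4 := congrArg (· ^ 6) h2
    simp only [mul_pow, one_pow] at h4
    rw [h1]
    linear_combination (-η (g⁻¹ • τ : ℍ) ^ 12 * etaSignSL g⁻¹ * etaSignSL g) * h4 -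
      η (g⁻¹ • τ : ℍ) ^ 12 * h3

lemma coe_SL_smul (γ : SL(2, ℤ)) (τ : ℍ) :
    ((γ • τ : ℍ) : ℂ) = (γ 0 0 * τ + γ 0 1) / (γ 1 0 * τ + γ 1 1) := by
  rw [coe_specialLinearGroup_apply]
  simp

lemma eta_moebius_pow_twelve {a b c d : ℤ} (h : a * d - b * c = 1) {z : ℂ} (hz : 0 < z.im) :
    η ((a * z + b) / (c * z + d)) ^ 12 = etaSign a b c d * (c * z + d) ^ 6 * η z ^ 12 := by
  obtain ⟨γ, rfl, rfl, rfl, rfl⟩ : ∃ γ : SL(2, ℤ), γ 0 0 = a ∧ γ 0 1 = b ∧ γ 1 0 = c ∧ γ 1 1 = d :=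
    ⟨⟨!![a, b; c, d], by simpa [Matrix.det_fin_two] using h⟩, rfl, rfl, rfl, rfl⟩
  have key := eta_smul_pow_twelve γ ⟨z, hz⟩
  rwa [coe_SL_smul, ModularGroup.denom_apply] at key

/-! ### Rigidity and the behaviour of `η¹²` under rational translations -/

/-- Two continuous functions on the upper half-plane whose `n`-th powers are proportional are
themselves proportional: their quotient takes finitely many values. -/
lemma exists_eq_const_mul_of_pow_eq {F G : ℍ → ℂ} (hF : Continuous F) (hG : Continuous G)
    (hG0 : ∀ τ, G τ ≠ 0) {n : ℕ} (hn : 0 < n) {K : ℂ} (h : ∀ τ, F τ ^ n = K * G τ ^ n) :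
    ∃ C : ℂ, ∀ τ, F τ = C * G τ := by
  have hfin : {x : ℂ | x ^ n = K}.Finite :=
    ((Polynomial.nthRoots n K).toFinset.finite_toSet).subset fun x hx => by
      simpa [Polynomial.mem_nthRoots hn] using hx
  refine ⟨F UpperHalfPlane.I / G UpperHalfPlane.I, fun τ => ?_⟩
  have := isPreconnected_univ.constant_of_mapsTo (f := fun τ => F τ / G τ) hfin.isDiscrete
    (hF.div hG hG0).continuousOn (fun τ _ => ?_) (Set.mem_univ τ) (Set.mem_univ UpperHalfPlane.I)
  · rw [← this, div_mul_cancel₀ _ (hG0 τ)]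
  · simp [div_pow, h, hG0]

/-- For `γ ∈ SL(2, ℤ)` and a rational translation by `j / u`, the integral matrix
`(u, j; 0, u) γ` is an element of `SL(2, ℤ)` times an upper triangular matrix `(α, β; 0, δ)` with
`α δ = u ^ 2`. The automorphy factor of `η¹²` then differs from that of `γ` by a constant only. -/
lemma exists_eta_smul_add_pow_twelve (γ : SL(2, ℤ)) {u : ℕ} (hu : 0 < u) (j : ℤ) :
    ∃ (α δ : ℕ) (β : ℤ) (K : ℂ), 0 < δ ∧ α * δ = u ^ 2 ∧ ∀ τ : ℍ,
      η ((γ • τ : ℍ) + j / u) ^ 12 = K * denom γ τ ^ 6 * η ((α * τ + β) / δ) ^ 12 := by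
  have hdet := γ.det_coe
  rw [Matrix.det_fin_two] at hdet
  have hden := fun τ : ℍ => denom_ne_zero (γ : GL (Fin 2) ℝ) τ
  simp only [coe_SL_smul, ModularGroup.denom_apply] at hden ⊢
  generalize γ 0 0 = a, γ 0 1 = b, γ 1 0 = c, γ 1 1 = d at *
  have hgpos : 0 < Int.gcd (u * a + j * c) (u * c) := by
    rw [Int.gcd_pos_iff]
    by_contra! hcon
    obtain ⟨h1, h2⟩ := hcon
    have hc : c = 0 := by simpa [hu.ne'] using h2
    subst hc
    have ha : a = 0 := by simpa [hu.ne'] using h1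
    simp [ha] at hdet
  -- `g` times the primitive vector `(p, r)` is the first column of `(u, j; 0, u) γ`; completing
  -- `(p, r)` to an element of `SL(2, ℤ)` and dividing by it leaves an upper triangular matrix
  obtain ⟨g, p, r, hg, hcop, hp, hr⟩ := Int.exists_gcd_one' hgpos
  obtain ⟨s, t, hst⟩ := Int.isCoprime_iff_gcd_eq_one.2 hcop
  have hδ : g * (-r * (u * b + j * d) + p * (u * d)) = (u : ℤ) ^ 2 := by
    linear_combination -(u * d) * hp + (u * b + j * d) * hr + u ^ 2 * hdet
  have hδpos : 0 < -r * (u * b + j * d) + p * (u * d) :=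
    pos_of_mul_pos_right (hδ ▸ by positivity) (Int.natCast_nonneg g)
  obtain ⟨δ, hδe⟩ := Int.eq_ofNat_of_zero_le hδpos.le
  rw [hδe] at hδ hδpos
  have hδ0 : 0 < δ := by exact_mod_cast hδpos
  have hdet' : p * s - (-t) * r = 1 := by linear_combination hst
  refine ⟨g, δ, s * (u * b + j * d) + t * (u * d), etaSign p (-t) r s * (u / δ) ^ 6, hδ0,
    by exact_mod_cast hδ, fun τ => ?_⟩
  have hw : 0 < ((g * τ + (s * (u * b + j * d) + t * (u * d) : ℤ)) / δ : ℂ).im := by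
    rw [Complex.div_natCast_im]
    have := τ.im_pos
    simp
    positivity
  have key := eta_moebius_pow_twelve hdet' hw
  have hu0 : (u : ℂ) ≠ 0 := by exact_mod_cast hu.ne'
  have hδ0' : (δ : ℂ) ≠ 0 := by exact_mod_cast hδ0.ne'
  have hC : ∀ {m n : ℤ}, m = n → (m : ℂ) = n := fun h => by rw [h]
  have hp' := hC hp
  have hr' := hC hr
  have hδe' := hC hδe
  have hst' := hC hst
  push_cast at hp' hr' hδe' hst' key ⊢
  -- the two affine functions produced by the factorisation of `(u, j; 0, u) γ`
  have hnum : (p : ℂ) * ((g * τ + (s * (u * b + j * d) + t * (u * d))) / δ) + -t =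
      ((u * a + j * c) * τ + (u * b + j * d)) / δ := by
    field_simp
    linear_combination (-τ : ℂ) * hp' + (-t) * hδe'.symm + (u * b + j * d : ℂ) * hst'
  have hdn : (r : ℂ) * ((g * τ + (s * (u * b + j * d) + t * (u * d))) / δ) + s =
      u * (c * τ + d) / δ := by
    field_simp
    linear_combination (-τ : ℂ) * hr' + s * hδe'.symm + (u * d : ℂ) * hst'
  rw [hnum, hdn] at key
  convert! key using 2
  · congr 1
    rw [div_add_div _ _ (hden τ) hu0, div_div_div_cancel_right₀ hδ0',
      div_eq_div_iff (mul_ne_zero (hden τ) hu0) (mul_ne_zero hu0 (hden τ))]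
    ring
  · ring

/-! ### Multipliers -/

lemma continuous_SL_smul (γ : SL(2, ℤ)) : Continuous fun τ : ℍ => γ • τ :=
  continuous_const_smul (γ : GL (Fin 2) ℝ)

/-- If the twelfth power of a continuous nowhere vanishing function is `Γ`-invariant, then the
function itself transforms under `Γ` by a character with values in the twelfth roots of unity. -/
lemma exists_multiplier {Γ : Subgroup SL(2, ℤ)} {f : ℍ → ℂ} (hf : Continuous f)
    (hf0 : ∀ τ, f τ ≠ 0) (h : ∀ γ ∈ Γ, ∀ τ, f (γ • τ) ^ 12 = f τ ^ 12) :
    ∃ ν : Γ →* ℂˣ, (∀ (γ : Γ) (τ : ℍ), f ((γ : SL(2, ℤ)) • τ) = (ν γ : ℂ) * f τ) ∧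
      ∀ γ, ν γ ^ 12 = 1 := by
  have hc : ∀ γ : Γ, ∃ c : ℂˣ, ∀ τ, f ((γ : SL(2, ℤ)) • τ) = (c : ℂ) * f τ := fun γ => by
    obtain ⟨C, hC⟩ := exists_eq_const_mul_of_pow_eq (F := fun τ => f ((γ : SL(2, ℤ)) • τ)) (G := f)
      (hf.comp (continuous_SL_smul _)) hf hf0 (n := 12) (by norm_num) (K := 1)
      (fun τ => by simpa using h γ γ.2 τ)
    have hC0 : C ≠ 0 := fun h0 => hf0 ((γ : SL(2, ℤ)) • UpperHalfPlane.I) (by rw [hC, h0, zero_mul])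
    exact ⟨Units.mk0 C hC0, hC⟩
  choose c hc using hc
  have huniq : ∀ {x y : ℂˣ}, (x : ℂ) * f UpperHalfPlane.I = y * f UpperHalfPlane.I → x = y :=
    fun hxy => Units.ext (mul_right_cancel₀ (hf0 _) hxy)
  refine ⟨MonoidHom.mk' c fun γ δ => huniq ?_, hc, fun γ => Units.ext ?_⟩
  · rw [← hc, Subgroup.coe_mul, mul_smul, hc, hc]
    push_cast
    ring
  · have h1 := h γ γ.2 UpperHalfPlane.I
    rw [hc, mul_pow] at h1
    simpa [hf0] using h1

/-! ### Products of translates of `η` -/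

/-- The hypotheses on a quadratic character `χ` modulo `u`, and on a system of integral
representatives `r` of the residue classes modulo `u`, under which the product of the
`η(τ + r x / u) ^ χ x` is modular on `Γ₀(u²)` up to twelfth roots of unity. The condition
`fiber` expresses that `χ` is primitive and quadratic (both sides vanish if `n` is not a unit); `sign` says that the matrices in `SL(2, ℤ)`
relating the translates by `r x / u` and `r (x d²) / u` all have the same sign. -/
structure TwistDatum (u : ℕ) [NeZero u] (χ : MulChar (ZMod u) ℤ) (r : ZMod u → ℤ) : Prop where
  one_lt : 1 < u
  rep : ∀ x, (r x : ZMod u) = x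
  fiber : ∀ n c : ZMod u, ∑ x with x * n = c, χ x = χ (c * n)
  exists_neg : ∃ b, χ b = -1
  sign : ∀ a b c d : ℤ, a * d - b * (u ^ 2 * c) = 1 → ∃ σ : ℂ, ∀ (x : ZMod u) (k : ℤ), χ x ≠ 0 →
    u * k = r x * d - r (x * d ^ 2) * a →
    etaSign (a + r x * u * c) (b + k - r x * r (x * d ^ 2) * c) (u ^ 2 * c)
      (d - r (x * d ^ 2) * u * c) = σ

/-- The product of the translates `η(τ + r x / u)`, with exponents `χ x`. -/
noncomputable def etaTwist {u : ℕ} [NeZero u] (χ : MulChar (ZMod u) ℤ) (r : ZMod u → ℤ) (z : ℂ) : ℂ :=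
  ∏ x, η (z + r x / u) ^ χ x

variable {u : ℕ} [NeZero u] {χ : MulChar (ZMod u) ℤ} {r : ZMod u → ℤ}

lemma im_add_div_pos {z : ℂ} (hz : 0 < z.im) (j : ℤ) (n : ℕ) : 0 < (z + j / n).im := by
  rw [Complex.add_im, Complex.div_natCast_im]
  simpa using hz

lemma eta_translate_ne_zero {z : ℂ} (hz : 0 < z.im) (j : ℤ) (n : ℕ) : η (z + j / n) ≠ 0 :=
  eta_ne_zero (im_add_div_pos hz j n)

lemma etaTwist_ne_zero {z : ℂ} (hz : 0 < z.im) : etaTwist χ r z ≠ 0 :=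
  Finset.prod_ne_zero_iff.2 fun _ _ => zpow_ne_zero _ (eta_translate_ne_zero hz _ _)

lemma differentiableAt_eta_translate {z : ℂ} (hz : 0 < z.im) (j : ℤ) (n : ℕ) :
    DifferentiableAt ℂ (fun w => η (w + j / n)) z :=
  (differentiableAt_eta_of_mem_upperHalfPlaneSet (im_add_div_pos hz j n)).comp z
    (differentiableAt_id.add_const _)

lemma differentiableAt_etaTwist {z : ℂ} (hz : 0 < z.im) : DifferentiableAt ℂ (etaTwist χ r) z :=
  DifferentiableAt.fun_finsetProd fun _ _ =>
    (differentiableAt_eta_translate hz _ _).zpow (Or.inl (eta_translate_ne_zero hz _ _))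

lemma continuous_etaTwist : Continuous fun τ : ℍ => etaTwist χ r τ :=
  continuous_iff_continuousAt.2 fun τ =>
    (differentiableAt_etaTwist τ.im_pos).continuousAt.comp continuous_coe.continuousAt

lemma prod_zpow_eq_zpow_sum {ι : Type*} {c : ℂ} (hc : c ≠ 0) (e : ι → ℤ) (s : Finset ι) :
    ∏ i ∈ s, c ^ e i = c ^ ∑ i ∈ s, e i := by
  classical
  induction s using Finset.induction_on with
  | empty => simp
  | insert i s hi ih => rw [Finset.prod_insert hi, Finset.sum_insert hi, ih, zpow_add₀ hc]

namespace TwistDatum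

lemma sum_eq_zero (D : TwistDatum u χ r) : ∑ x, χ x = 0 := by
  have : Fact (1 < u) := ⟨D.one_lt⟩
  simpa [MulChar.map_nonunit] using D.fiber 0 0

/-- A common factor of all terms drops out of a product with exponents `χ x`. -/
lemma prod_const_mul_zpow (D : TwistDatum u χ r) {c : ℂ} (hc : c ≠ 0) (f : ZMod u → ℂ) :
    ∏ x, (c * f x) ^ χ x = ∏ x, f x ^ χ x := by
  simp_rw [mul_zpow]
  rw [Finset.prod_mul_distrib, prod_zpow_eq_zpow_sum hc, D.sum_eq_zero, zpow_zero, one_mul]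

lemma etaTwist_pow (z : ℂ) (n : ℕ) : etaTwist χ r z ^ n = ∏ x, (η (z + r x / u) ^ n) ^ χ x := by
  rw [etaTwist, ← Finset.prod_pow]
  refine Finset.prod_congr rfl fun x _ => ?_
  rw [← zpow_natCast, ← zpow_natCast, zpow_comm]

/-- The twelfth power of the product of translates is invariant under `Γ₀(u²)`. -/
lemma etaTwist_smul_pow (D : TwistDatum u χ r) {γ : SL(2, ℤ)} (hγ : γ ∈ Gamma0 (u ^ 2)) (τ : ℍ) :
    etaTwist χ r (γ • τ : ℍ) ^ 12 = etaTwist χ r τ ^ 12 := by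
  have hdet := γ.det_coe
  rw [Matrix.det_fin_two] at hdet
  rw [Gamma0_mem, ZMod.intCast_zmod_eq_zero_iff_dvd] at hγ
  have hden := denom_ne_zero (γ : GL (Fin 2) ℝ) τ
  simp only [ModularGroup.denom_apply] at hden
  rw [etaTwist_pow, etaTwist_pow, coe_SL_smul]
  generalize γ 0 0 = a, γ 0 1 = b, γ 1 0 = c₀, γ 1 1 = d at *
  obtain ⟨c, rfl⟩ := hγ
  push_cast at hdet hden ⊢
  obtain ⟨σ, hσ⟩ := D.sign a b c d hdet
  have hu0 : (u : ℂ) ≠ 0 := by exact_mod_cast NeZero.ne u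
  have hadu : (a : ZMod u) * d = 1 := by
    have := congrArg (Int.cast : ℤ → ZMod u) hdet
    simpa using this
  have hunit : IsUnit (d : ZMod u) := IsUnit.of_mul_eq_one_right _ hadu
  have hχd : χ ((d : ZMod u) ^ 2) = 1 := by
    rw [map_pow]
    exact Int.isUnit_sq (hunit.map χ)
  have hχ : ∀ x, χ (x * d ^ 2) = χ x := fun x => by rw [map_mul, hχd, mul_one]
  have hσ0 : σ ≠ 0 := by
    obtain ⟨x, hx⟩ := D.exists_neg
    have hdvd : (u : ℤ) ∣ r x * d - r (x * d ^ 2) * a := by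
      rw [← ZMod.intCast_zmod_eq_zero_iff_dvd]
      push_cast
      rw [D.rep, D.rep]
      linear_combination (-x * d) * hadu
    obtain ⟨k, hk⟩ := hdvd
    rw [← hσ x k (by rw [hx]; norm_num) hk.symm]
    intro h0
    have := etaSign_sq (a + r x * u * c) (b + k - r x * r (x * d ^ 2) * c) (u ^ 2 * c)
      (d - r (x * d ^ 2) * u * c)
    simp [h0] at this
  -- the `x`-th factor at `γ τ` is the `(x d²)`-th factor at `τ`, up to a factor independent of `x`
  have hterm : ∀ x, (η ((a * τ + b) / (u ^ 2 * c * τ + d) + r x / u) ^ 12) ^ χ x =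
      (σ * (u ^ 2 * c * τ + d) ^ 6 * η (τ + r (x * d ^ 2) / u) ^ 12) ^ χ (x * d ^ 2) := fun x => by
    rw [hχ]
    by_cases hx : χ x = 0
    · simp [hx]
    congr 1
    have hdvd : (u : ℤ) ∣ r x * d - r (x * d ^ 2) * a := by
      rw [← ZMod.intCast_zmod_eq_zero_iff_dvd]
      push_cast
      rw [D.rep, D.rep]
      linear_combination (-x * d) * hadu
    obtain ⟨k, hk⟩ := hdvd
    have hs := hσ x k hx hk.symm
    set j := r x
    set j' := r (x * d ^ 2)
    have hd1 : (a + j * u * c) * (d - j' * u * c) - (b + k - j * j' * c) * (u ^ 2 * c) = 1 := by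
      linear_combination hdet + u * c * hk
    have key := eta_moebius_pow_twelve hd1 (im_add_div_pos τ.im_pos j' u)
    rw [hs] at key
    have hk' : (j * d - j' * a : ℂ) = u * k := by exact_mod_cast hk
    push_cast at key
    have e1 : (u : ℂ) ^ 2 * c * (τ + j' / u) + (d - j' * u * c) = u ^ 2 * c * τ + d := by
      field_simp
      ring
    have e2 : ((a : ℂ) + j * u * c) * (τ + j' / u) + (b + k - j * j' * c) =
        (a * τ + b) + j / u * (u ^ 2 * c * τ + d) := by
      field_simp
      linear_combination -hk'
    rw [e1, e2, add_div, mul_div_cancel_right₀ _ hden] at key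
    exact key
  rw [Finset.prod_congr rfl fun x _ => hterm x, ← D.prod_const_mul_zpow
    (mul_ne_zero hσ0 (pow_ne_zero 6 hden)) (fun x => η (τ + r x / u) ^ 12)]
  exact Equiv.prod_comp ((hunit.pow 2).unit.mulRight)
    (fun y => (σ * (u ^ 2 * c * τ + d) ^ 6 * η (τ + r y / u) ^ 12) ^ χ y)

end TwistDatum


/-! ### Expansions at the cusps -/

/-- The product `∏ (1 - x ^ n)` over `n ≥ 1`. -/
noncomputable def eulerProduct (x : ℂ) : ℂ := ∏' n : ℕ, (1 - x ^ (n + 1))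

lemma analyticAt_eulerProduct_zero : AnalyticAt ℂ eulerProduct 0 :=
  differentiableOn_tprod_one_sub_pow.analyticAt (Metric.ball_mem_nhds 0 one_pos)

lemma eta_eq_exp_mul_eulerProduct (z : ℂ) :
    η z = exp (2 * Real.pi * Complex.I * z / 24) *
      eulerProduct (exp (2 * Real.pi * Complex.I * z)) := by
  simp [ModularForm.eta, eta_q, eulerProduct, Function.Periodic.qParam]

/-- The expansion of `η ((α τ + β) / δ)` in the parameter `exp (2πiτ / h)` with `h = 2 u²`,
where `α δ = u²`. -/
lemma exists_eta_affine_expansion {u α δ : ℕ} (hδ : 0 < δ) (hu : 0 < u) (h : α * δ = u ^ 2)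
    (β : ℤ) : ∃ G : ℂ → ℂ, MeromorphicAt G 0 ∧ ∀ τ : ℂ, η ((α * τ + β) / δ) =
      exp (2 * Real.pi * Complex.I * ((α ^ 2 : ℤ) / 12) * τ / (2 * u ^ 2 : ℕ)) *
        G (Function.Periodic.qParam (2 * u ^ 2 : ℕ) τ) := by
  have hα : α ≠ 0 := by
    rintro rfl
    exact (pow_pos hu 2).ne (by simpa using h)
  have hu0 : (u : ℂ) ≠ 0 := by exact_mod_cast hu.ne'
  have hδ0 : (δ : ℂ) ≠ 0 := by exact_mod_cast hδ.ne'
  have h' : (α : ℂ) * δ = u ^ 2 := by exact_mod_cast h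
  refine ⟨fun x => exp (2 * Real.pi * Complex.I * (β / δ) / 24) *
    eulerProduct (exp (2 * Real.pi * Complex.I * (β / δ)) * x ^ (2 * α ^ 2)), ?_, fun τ => ?_⟩
  · refine (MeromorphicAt.const _ _).mul (AnalyticAt.meromorphicAt ?_)
    have h0 : exp (2 * Real.pi * Complex.I * (β / δ)) * 0 ^ (2 * α ^ 2) = 0 := by
      simp [hα]
    exact AnalyticAt.comp (g := eulerProduct) (by rw [h0]; exact analyticAt_eulerProduct_zero)
      (by fun_prop)
  · have hq : exp (2 * Real.pi * Complex.I * ((α * τ + β) / δ)) =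
        exp (2 * Real.pi * Complex.I * (β / δ)) *
          Function.Periodic.qParam (2 * u ^ 2 : ℕ) τ ^ (2 * α ^ 2) := by
      rw [Function.Periodic.qParam, ← Complex.exp_nat_mul, ← Complex.exp_add]
      congr 1
      push_cast
      field_simp
      rw [← h']
      ring
    have hq' : exp (2 * Real.pi * Complex.I * ((α * τ + β) / δ) / 24) =
        exp (2 * Real.pi * Complex.I * ((α ^ 2 : ℤ) / 12) * τ / (2 * u ^ 2 : ℕ)) *
          exp (2 * Real.pi * Complex.I * (β / δ) / 24) := by
      rw [← Complex.exp_add]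
      congr 1
      push_cast
      field_simp
      rw [← h']
      ring
    rw [eta_eq_exp_mul_eulerProduct, hq, hq']
    ring

/-- At every cusp the product of translates of `η` is a constant times a product of powers of
functions `η ((α τ + β) / δ)`. -/
lemma TwistDatum.exists_etaTwist_smul_eq (D : TwistDatum u χ r) (γ : SL(2, ℤ)) :
    ∃ (α δ : ZMod u → ℕ) (β : ZMod u → ℤ) (C : ℂ), (∀ x, 0 < δ x) ∧ (∀ x, α x * δ x = u ^ 2) ∧
      ∀ τ : ℍ, etaTwist χ r (γ • τ : ℍ) = C * ∏ x, η ((α x * τ + β x) / δ x) ^ χ x := by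
  have hu : 0 < u := Nat.pos_of_neZero u
  choose α δ β K hδ hαδ h using fun x => exists_eta_smul_add_pow_twelve γ hu (r x)
  have hα : ∀ x, 0 < α x := fun x => Nat.pos_of_ne_zero fun h0 => by
    exact (pow_pos hu 2).ne (by simpa [h0] using hαδ x)
  have him : ∀ (x) (τ : ℍ), 0 < ((α x * τ + β x) / δ x : ℂ).im := fun x τ => by
    have := hα x
    have := hδ x
    have := τ.im_pos
    rw [Complex.div_natCast_im]
    simp
    positivity
  have hne : ∀ (x) (τ : ℍ), η ((α x * τ + β x) / δ x) ≠ 0 := fun x τ => eta_ne_zero (him x τ)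
  have hcont : Continuous fun τ : ℍ => ∏ x, η ((α x * τ + β x) / δ x) ^ χ x := by
    refine continuous_finsetProd _ fun x _ => Continuous.zpow₀ ?_ _ fun τ => Or.inl (hne x τ)
    refine continuous_iff_continuousAt.2 fun τ => ContinuousAt.comp
      (f := fun τ : ℍ => ((α x * τ + β x) / δ x : ℂ)) (g := η)
      (differentiableAt_eta_of_mem_upperHalfPlaneSet (him x τ)).continuousAt ?_
    fun_prop
  have hpow : ∀ τ : ℍ, etaTwist χ r (γ • τ : ℍ) ^ 12 =
      (∏ x, K x ^ χ x) * (∏ x, η ((α x * τ + β x) / δ x) ^ χ x) ^ 12 := fun τ => by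
    have hd := pow_ne_zero 6 (denom_ne_zero (γ : GL (Fin 2) ℝ) τ)
    rw [etaTwist_pow]
    simp_rw [h, mul_comm (K _) _, mul_assoc]
    rw [D.prod_const_mul_zpow hd]
    simp_rw [mul_zpow]
    rw [Finset.prod_mul_distrib, ← Finset.prod_pow]
    congr 1
    refine Finset.prod_congr rfl fun x _ => ?_
    rw [← zpow_natCast, ← zpow_natCast, zpow_comm]
  obtain ⟨C, hC⟩ := exists_eq_const_mul_of_pow_eq
    (continuous_etaTwist.comp (continuous_SL_smul γ)) hcont
    (fun τ => Finset.prod_ne_zero_iff.2 fun x _ => zpow_ne_zero _ (hne x τ)) (by norm_num) hpow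
  exact ⟨α, δ, β, C, hδ, hαδ, hC⟩

lemma TwistDatum.exists_etaTwist_expansion (D : TwistDatum u χ r) (γ : SL(2, ℤ)) :
    ∃ (m : ℤ) (G : ℂ → ℂ), MeromorphicAt G 0 ∧ ∀ τ : ℍ, etaTwist χ r (γ • τ : ℍ) =
      exp (2 * Real.pi * Complex.I * (m / 12) * τ / (2 * u ^ 2 : ℕ)) *
        G (Function.Periodic.qParam (2 * u ^ 2 : ℕ) τ) := by
  obtain ⟨α, δ, β, C, hδ, hαδ, hC⟩ := D.exists_etaTwist_smul_eq γ
  choose G hG h using fun x =>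
    exists_eta_affine_expansion (hδ x) (Nat.pos_of_neZero u) (hαδ x) (β x)
  refine ⟨∑ x, α x ^ 2 * χ x, fun q => C * ∏ x, G x q ^ χ x,
    (MeromorphicAt.const _ _).mul (MeromorphicAt.fun_prod fun x _ => (hG x).fun_zpow _),
    fun τ => ?_⟩
  rw [hC]
  simp_rw [h, mul_zpow, ← Complex.exp_int_mul]
  rw [Finset.prod_mul_distrib, ← Complex.exp_sum]
  rw [mul_left_comm]
  congr 2
  push_cast
  rw [Finset.sum_div, Finset.mul_sum, Finset.sum_mul, Finset.sum_div]
  exact Finset.sum_congr rfl fun x _ => by ring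

/-! ### Modularity and divisor of a constant multiple of the product of translates -/

lemma conj_T_pow_mem_Gamma0 {N h : ℕ} (hN : N ∣ h) (γ : SL(2, ℤ)) :
    γ * ModularGroup.T ^ h * γ⁻¹ ∈ Gamma0 N := by
  have h1 : ModularGroup.T ^ h ∈ CongruenceSubgroup.Gamma N := by
    simpa using ModularGroup_T_pow_mem_Gamma N h (by exact_mod_cast hN)
  have h2 := (Gamma_normal N).conj_mem _ h1 γ
  rw [Gamma0_mem]
  exact (Gamma_mem.1 h2).2.2.1

lemma hasCuspidalDivisor_of_differentiable {f : ℍ → ℂ}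
    (hf : DifferentiableOn ℂ (fun z : ℂ => f (ofComplex z)) {z : ℂ | 0 < z.im})
    (h0 : ∀ τ, f τ ≠ 0) : HasCuspidalDivisor f := fun z hz => by
  have han : AnalyticAt ℂ (fun w : ℂ => f (ofComplex w)) z :=
    hf.analyticAt (isOpen_upperHalfPlaneSet.mem_nhds hz)
  exact ⟨han.meromorphicAt, by
    rw [han.meromorphicOrderAt_eq, han.analyticOrderAt_eq_zero.2 (h0 _)]; rfl⟩

namespace TwistDatum

variable {f : ℍ → ℂ} {C : ℂ}

lemma differentiableOn (hf : ∀ τ : ℍ, f τ = C * etaTwist χ r τ) :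
    DifferentiableOn ℂ (fun z : ℂ => f (ofComplex z)) {z : ℂ | 0 < z.im} := fun z hz => by
  refine DifferentiableWithinAt.congr (f := fun z => C * etaTwist χ r z)
    ((differentiableAt_etaTwist hz).const_mul C).differentiableWithinAt (fun w hw => ?_) ?_
  · rw [hf, ofComplex_apply_of_im_pos hw]
  · rw [hf, ofComplex_apply_of_im_pos hz]

lemma isGMF (D : TwistDatum u χ r) (hC : C ≠ 0) (hf : ∀ τ : ℍ, f τ = C * etaTwist χ r τ) :
    IsGMFWithTwelfthRootMultiplier (Gamma0 (u ^ 2)) f := by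
  obtain rfl : f = fun τ : ℍ => C * etaTwist χ r τ := funext hf
  obtain ⟨ν, hν, hν12⟩ := exists_multiplier (Γ := Gamma0 (u ^ 2))
    (f := fun τ : ℍ => C * etaTwist χ r τ)
    (continuous_const.mul continuous_etaTwist) (fun τ => mul_ne_zero hC (etaTwist_ne_zero τ.im_pos))
    (fun γ hγ τ => by rw [mul_pow, mul_pow, D.etaTwist_smul_pow hγ])
  refine ⟨ν, ⟨differentiableOn hf, hν, fun γ => ?_⟩, fun γ => ⟨?_, hν12 γ⟩⟩
  · obtain ⟨m, G, hG, h⟩ := D.exists_etaTwist_expansion γ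
    refine ⟨2 * u ^ 2, by have := Nat.pos_of_neZero u; positivity,
      conj_T_pow_mem_Gamma0 (Dvd.intro_left 2 rfl) γ, m / 12, fun q => C * G q,
      (MeromorphicAt.const _ _).mul hG, .of_forall fun τ => ?_⟩
    rw [h]
    ring
  · refine norm_eq_one_of_pow_eq_one (n := 12) ?_ (by norm_num)
    simpa using congrArg Units.val (hν12 γ)

lemma isModularFunction_pow (D : TwistDatum u χ r) (hf : ∀ τ : ℍ, f τ = C * etaTwist χ r τ) :
    IsModularFunction (Gamma0 (u ^ 2)) (fun τ => f τ ^ 12) where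
  mero z hz := (((differentiableOn hf).analyticAt
    (isOpen_upperHalfPlaneSet.mem_nhds hz)).pow 12).meromorphicAt
  invariant γ hγ τ := by rw [hf, hf, mul_pow, mul_pow, D.etaTwist_smul_pow hγ]
  mero_cusps γ := by
    obtain ⟨m, G, hG, h⟩ := D.exists_etaTwist_expansion γ
    refine ⟨2 * u ^ 2, by have := Nat.pos_of_neZero u; positivity,
      conj_T_pow_mem_Gamma0 (Dvd.intro_left 2 rfl) γ, fun q => C ^ 12 * (q ^ m * G q ^ 12),
      (MeromorphicAt.const _ _).mul ((MeromorphicAt.id 0).fun_zpow m |>.mul (hG.pow 12)),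
      .of_forall fun τ => ?_⟩
    rw [hf, h, mul_pow, mul_pow, ← Complex.exp_nat_mul, Function.Periodic.qParam]
    beta_reduce
    rw [← Complex.exp_int_mul]
    congr 3
    push_cast
    ring

lemma hasCuspidalDivisor (hC : C ≠ 0) (hf : ∀ τ : ℍ, f τ = C * etaTwist χ r τ) :
    HasCuspidalDivisor f :=
  hasCuspidalDivisor_of_differentiable (differentiableOn hf) fun τ => by
    rw [hf]; exact mul_ne_zero hC (etaTwist_ne_zero τ.im_pos)

lemma hasCuspidalDivisor_pow (hC : C ≠ 0) (hf : ∀ τ : ℍ, f τ = C * etaTwist χ r τ) :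
    HasCuspidalDivisor (fun τ => f τ ^ 12) :=
  hasCuspidalDivisor_of_differentiable ((differentiableOn hf).pow 12) fun τ => by
    rw [hf]; exact pow_ne_zero 12 (mul_ne_zero hC (etaTwist_ne_zero τ.im_pos))

end TwistDatum

/-! ### The generalized eta product as a product of translates -/

lemma prod_Icc_one_natCast_zmod (F : ZMod u → ℂ) :
    ∏ a ∈ Finset.Icc 1 u, F (a : ZMod u) = ∏ c, F c := by
  have hu := Nat.pos_of_neZero u
  refine Finset.prod_bij (fun a _ => (a : ZMod u)) (fun _ _ => Finset.mem_univ _)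
    (fun a ha b hb hab => ?_) (fun c _ => ?_) fun _ _ => rfl
  · rw [Finset.mem_Icc] at ha hb
    have h1 : (a : ℤ) ≡ b [ZMOD u] := by
      rw [← ZMod.intCast_eq_intCast_iff]
      exact_mod_cast hab
    obtain ⟨k, hk⟩ := h1.symm.dvd
    have : k = 0 := by
      have h3 : (u : ℤ) * k < u * 1 := by omega
      have h4 : (u : ℤ) * (-1) < u * k := by omega
      have := lt_of_mul_lt_mul_left h3 (by positivity)
      have := lt_of_mul_lt_mul_left h4 (by positivity)
      omega
    subst this
    omega
  · by_cases hc : c = 0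
    · exact ⟨u, by simp; omega, by simp [hc]⟩
    · refine ⟨c.val, ?_, by simp⟩
      have h1 := ZMod.val_lt c
      have h2 : c.val ≠ 0 := by simpa [ZMod.val_eq_zero] using hc
      rw [Finset.mem_Icc]
      omega

lemma norm_exp_two_pi_I_mul_lt_one {z : ℂ} (hz : 0 < z.im) :
    ‖exp (2 * Real.pi * Complex.I * z)‖ < 1 :=
  norm_exp_two_pi_I_lt_one ⟨z, hz⟩

lemma one_sub_pow_ne_zero {q : ℂ} (hq : ‖q‖ < 1) {n : ℕ} (hn : n ≠ 0) : 1 - q ^ n ≠ 0 := by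
  intro h
  have h1 : ‖q ^ n‖ < 1 := by
    rw [norm_pow]
    exact pow_lt_one₀ (norm_nonneg _) hq hn
  rw [← sub_eq_zero.1 h, norm_one] at h1
  exact lt_irrefl _ h1

lemma exp_translate_pow (D : TwistDatum u χ r) (z : ℂ) (x : ZMod u) (n : ℕ) :
    exp (2 * Real.pi * Complex.I * (z + r x / u)) ^ n =
      ZMod.stdAddChar (x * (n : ZMod u)) * exp (2 * Real.pi * Complex.I * z) ^ n := by
  have h1 : ZMod.stdAddChar x = exp (2 * Real.pi * Complex.I * r x / u) := by
    rw [← ZMod.stdAddChar_coe, D.rep]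
  have h2 : x * n = n • x := by rw [nsmul_eq_mul, mul_comm]
  rw [h2, AddChar.map_nsmul_eq_pow, h1, ← mul_pow, ← Complex.exp_add]
  ring_nf

/-- The `n`-th factor of `η_χ`, rearranged over the residue classes `x` with `a = x n`. -/
lemma TwistDatum.genEtaFactor_eq (D : TwistDatum u χ r) {X : DirichletCharacter ℂ u}
    (hX : X = χ.ringHomComp (Int.castRingHom ℂ)) (hcond : X.conductor = u) {n : ℕ} (hn : n ≠ 0)
    (τ : ℍ) : genEtaFactor X n τ =
      ∏ x, (1 - exp (2 * Real.pi * Complex.I * (τ + r x / u)) ^ n) ^ χ x := by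
  set q := exp (2 * Real.pi * Complex.I * τ) with hq
  have hterm : ∀ a : ℕ, (1 - exp (2 * Real.pi * Complex.I / u) ^ a * q ^ n) ^
      (starRingEnd ℂ (X ((a * n : ℕ) : ZMod u))) =
      (1 - ZMod.stdAddChar (a : ZMod u) * q ^ n) ^ χ ((a : ZMod u) * n) := fun a => by
    have h1 : ZMod.stdAddChar (a : ZMod u) = exp (2 * Real.pi * Complex.I / u) ^ a := by
      have := ZMod.stdAddChar_coe (N := u) a
      rw [Int.cast_natCast] at this
      rw [this, ← Complex.exp_nat_mul]
      congr 1
      push_cast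
      ring
    rw [hX, MulChar.ringHomComp_apply, h1]
    push_cast
    rw [eq_intCast, map_intCast, Complex.cpow_intCast]
  have hne : ∀ x : ZMod u, 1 - ZMod.stdAddChar (x * (n : ZMod u)) * q ^ n ≠ 0 := fun x => by
    rw [hq, ← exp_translate_pow D]
    exact one_sub_pow_ne_zero (norm_exp_two_pi_I_mul_lt_one (im_add_div_pos τ.im_pos _ _)) hn
  simp_rw [exp_translate_pow D, ← hq]
  rw [genEtaFactor, hcond, Finset.prod_congr rfl fun a _ => hterm a,
    prod_Icc_one_natCast_zmod fun c : ZMod u => (1 - ZMod.stdAddChar c * q ^ n) ^ χ (c * n),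
    ← Finset.prod_fiberwise Finset.univ (fun x : ZMod u => x * n)
      (fun x => (1 - ZMod.stdAddChar (x * (n : ZMod u)) * q ^ n) ^ χ x)]
  refine Finset.prod_congr rfl fun c _ => ?_
  rw [← D.fiber]
  by_cases hc : ∃ x : ZMod u, x * n = c
  · obtain ⟨x, rfl⟩ := hc
    rw [← prod_zpow_eq_zpow_sum (hne x)]
    refine Finset.prod_congr rfl fun y hy => ?_
    rw [(Finset.mem_filter.1 hy).2]
  · push Not at hc
    rw [Finset.filter_eq_empty_iff.2 fun x _ => hc x]
    simp

lemma hasProd_zpow {ι : Type*} {f : ι → ℂ} {a : ℂ} (h : HasProd f a) (ha : a ≠ 0) (k : ℤ) :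
    HasProd (fun i => f i ^ k) (a ^ k) := by
  have := Tendsto.zpow₀ h k (Or.inl ha)
  simpa [HasProd, Finset.prod_zpow] using this

lemma hasProd_eulerProduct {q : ℂ} (hq : ‖q‖ < 1) :
    HasProd (fun n : ℕ => 1 - q ^ (n + 1)) (eulerProduct q) :=
  (multipliable_one_sub_pow hq).hasProd

lemma eulerProduct_exp_ne_zero {z : ℂ} (hz : 0 < z.im) :
    eulerProduct (exp (2 * Real.pi * Complex.I * z)) ≠ 0 := fun h =>
  eta_ne_zero hz (by rw [eta_eq_exp_mul_eulerProduct, h, mul_zero])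

lemma TwistDatum.hasProd_genEtaFactor (D : TwistDatum u χ r) {X : DirichletCharacter ℂ u}
    (hX : X = χ.ringHomComp (Int.castRingHom ℂ)) (hcond : X.conductor = u) (τ : ℍ) :
    HasProd (fun n : ℕ => genEtaFactor X (n + 1) τ)
      (∏ x, eulerProduct (exp (2 * Real.pi * Complex.I * (τ + r x / u))) ^ χ x) := by
  simp_rw [D.genEtaFactor_eq hX hcond (Nat.succ_ne_zero _)]
  refine hasProd_prod fun x _ => ?_
  have him := im_add_div_pos τ.im_pos (r x) u
  exact hasProd_zpow (hasProd_eulerProduct (norm_exp_two_pi_I_mul_lt_one him))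
    (eulerProduct_exp_ne_zero him) _

/-- The factors `exp (2πiτ / 24)` in the definition of `η` cancel, since the exponents `χ x` have
sum zero. -/
lemma TwistDatum.exists_genEta_eq (D : TwistDatum u χ r) {X : DirichletCharacter ℂ u}
    (hX : X = χ.ringHomComp (Int.castRingHom ℂ)) (hcond : X.conductor = u) :
    ∃ C : ℂ, C ≠ 0 ∧ ∀ τ : ℍ, genEta X τ = C * etaTwist χ r τ := by
  have hC : ∏ x, exp (2 * Real.pi * Complex.I * (r x / u) / 24) ^ χ x ≠ 0 :=
    Finset.prod_ne_zero_iff.2 fun _ _ => zpow_ne_zero _ (Complex.exp_ne_zero _)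
  refine ⟨_, inv_ne_zero hC, fun τ => ?_⟩
  rw [genEta, (D.hasProd_genEtaFactor hX hcond τ).tprod_eq, eq_inv_mul_iff_mul_eq₀ hC, etaTwist,
    ← Finset.prod_mul_distrib]
  simp_rw [← mul_zpow]
  rw [← D.prod_const_mul_zpow (Complex.exp_ne_zero (2 * Real.pi * Complex.I * τ / 24))]
  refine Finset.prod_congr rfl fun x _ => ?_
  rw [eta_eq_exp_mul_eulerProduct, ← mul_assoc, ← Complex.exp_add]
  ring_nf


/-! ### The product of translates is not an `η`-quotient -/

/-- A power series that converges to zero on the interval `(0, 1)` has zero coefficients. -/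
lemma coeff_eq_zero_of_hasSum_zero {d : ℕ → ℂ}
    (h : ∀ q : ℝ, 0 < q → q < 1 → HasSum (fun m => d m * (q : ℂ) ^ m) 0) (m : ℕ) : d m = 0 := by
  induction m using Nat.strong_induction_on with
  | _ m ih =>
    have hs : ∀ q : ℝ, 0 < q → q < 1 → HasSum (fun n => d (n + m) * (q : ℂ) ^ n) 0 :=
      fun q h0 h1 => by
        have hq0 : (q : ℂ) ≠ 0 := by exact_mod_cast h0.ne'
        have h2 := (hasSum_nat_add_iff' m).2 (h q h0 h1)
        rw [Finset.sum_eq_zero fun i hi => by rw [ih i (Finset.mem_range.1 hi), zero_mul]] at h2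
        have h3 := h2.mul_right ((q : ℂ) ^ m)⁻¹
        simp only [sub_zero, zero_mul] at h3
        refine h3.congr_fun fun n => ?_
        rw [pow_add]
        field_simp
    have hb : Summable fun n => ‖d (n + m)‖ * (1 / 2 : ℝ) ^ n := by
      have := (hs (1 / 2) (by norm_num) (by norm_num)).summable.norm
      refine this.congr fun n => ?_
      simp
    have ht : Tendsto (fun q : ℝ => ∑' n, d (n + m) * (q : ℂ) ^ n) (nhdsWithin 0 (Set.Ioi 0))
        (nhds (∑' n, d (n + m) * (0 : ℂ) ^ n)) := by
      refine tendsto_tsum_of_dominated_convergence hb (fun n => ?_) ?_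
      · have : Continuous fun q : ℝ => d (n + m) * (q : ℂ) ^ n := by fun_prop
        simpa using (this.tendsto 0).mono_left nhdsWithin_le_nhds
      · filter_upwards [Ioo_mem_nhdsGT (show (0 : ℝ) < 1 / 2 by norm_num)] with q hq n
        rw [norm_mul, norm_pow, Complex.norm_real, Real.norm_of_nonneg hq.1.le]
        have := hq.1.le
        have := hq.2.le
        gcongr
    have h0 : Tendsto (fun q : ℝ => ∑' n, d (n + m) * (q : ℂ) ^ n) (nhdsWithin 0 (Set.Ioi 0))
        (nhds 0) := by
      refine tendsto_const_nhds.congr' ?_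
      filter_upwards [Ioo_mem_nhdsGT (show (0 : ℝ) < 1 by norm_num)] with q hq
      exact (hs q hq.1 hq.2).tsum_eq.symm
    have h1 := tendsto_nhds_unique ht h0
    rwa [tsum_eq_single 0 (fun n hn => by simp [hn]), pow_zero, mul_one, zero_add] at h1

/-- On the imaginary axis `η` takes positive real values, where the principal branch of the
complex power is holomorphic. -/
lemma eta_mem_slitPlane {z : ℂ} (hre : z.re = 0) (hz : 0 < z.im) : η z ∈ slitPlane := by
  obtain ⟨y, rfl⟩ : ∃ y : ℝ, z = y * Complex.I :=
    ⟨z.im, by apply Complex.ext <;> simp [hre]⟩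
  have hy : 0 < y := by simpa using hz
  have hq : exp (2 * Real.pi * Complex.I * (y * Complex.I)) =
      (Real.exp (-(2 * Real.pi * y)) : ℝ) := by
    push_cast
    congr 1
    linear_combination (2 * Real.pi * y : ℂ) * Complex.I_sq
  have hq' : exp (2 * Real.pi * Complex.I * (y * Complex.I) / 24) =
      (Real.exp (-(2 * Real.pi * y) / 24) : ℝ) := by
    push_cast
    congr 1
    linear_combination (2 * Real.pi * y / 24 : ℂ) * Complex.I_sq
  set q := Real.exp (-(2 * Real.pi * y)) with hqdef
  have hq1 : q < 1 := Real.exp_lt_one_iff.2 (by have := Real.pi_pos; nlinarith [mul_pos this hy])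
  have hq0 : 0 < q := Real.exp_pos _
  have hne : η (y * Complex.I) ≠ 0 := eta_ne_zero hz
  have hmult : Multipliable fun n : ℕ => 1 - q ^ (n + 1) := by
    apply multipliable_one_add_of_summable (f := fun n : ℕ ↦ -q ^ (n + 1))
    simpa [abs_of_pos hq0] using
      (summable_nat_add_iff 1).mpr (summable_geometric_of_lt_one hq0.le hq1)
  have hE : eulerProduct (q : ℂ) = ((∏' n : ℕ, (1 - q ^ (n + 1)) : ℝ) : ℂ) := by
    have := hmult.map_tprod Complex.ofRealHom Complex.continuous_ofReal
    simpa [eulerProduct] using this.symm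
  have hnn : 0 ≤ ∏' n : ℕ, (1 - q ^ (n + 1)) :=
    ge_of_tendsto' hmult.hasProd fun s => Finset.prod_nonneg fun n _ =>
      sub_nonneg.2 (pow_le_one₀ hq0.le hq1.le)
  rw [eta_eq_exp_mul_eulerProduct, hq, hq', hE, ← Complex.ofReal_mul] at hne ⊢
  rw [Complex.ofReal_mem_slitPlane]
  exact lt_of_le_of_ne (mul_nonneg (Real.exp_pos _).le hnn) fun h => hne (by rw [← h]; simp)

lemma hasSum_logDeriv_eta {z : ℂ} (hz : 0 < z.im) :
    HasSum (fun n : ℕ => (if n = 0 then 1 else -24 * ArithmeticFunction.sigma 1 n : ℂ) *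
      exp (2 * Real.pi * Complex.I * z) ^ n) (12 / (Real.pi * Complex.I) * logDeriv η z) := by
  have h := EisensteinSeries.hasSum_qExpansion_E2 (z := ⟨z, hz⟩)
  have h2 := logDeriv_eta_eq_E2 ⟨z, hz⟩
  have hpi : (Real.pi : ℂ) ≠ 0 := by exact_mod_cast Real.pi_ne_zero
  have : 12 / (Real.pi * Complex.I) * logDeriv η z = EisensteinSeries.E2 ⟨z, hz⟩ := by
    rw [h2]
    field_simp
  rw [this]
  simpa using h

/-- The Gauss sum of `χ` twisted by `n` is `χ n` times the Gauss sum of `χ`. -/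
lemma TwistDatum.gaussSum_mul (D : TwistDatum u χ r) (n : ZMod u) :
    ∑ x, (χ x : ℂ) * ZMod.stdAddChar (x * n) = χ n * ∑ x, (χ x : ℂ) * ZMod.stdAddChar x := by
  rw [← Finset.sum_fiberwise Finset.univ (fun x : ZMod u => x * n)
    (fun x => (χ x : ℂ) * ZMod.stdAddChar (x * n)), Finset.mul_sum]
  refine Finset.sum_congr rfl fun c _ => ?_
  have := congrArg (Int.cast : ℤ → ℂ) (D.fiber n c)
  rw [map_mul] at this
  push_cast at this
  rw [Finset.sum_congr rfl fun x hx => by rw [(Finset.mem_filter.1 hx).2], ← Finset.sum_mul, this]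
  ring

lemma TwistDatum.gaussSum_ne_zero (D : TwistDatum u χ r) :
    ∑ x, (χ x : ℂ) * ZMod.stdAddChar x ≠ 0 := fun h => by
  have h1 : ZMod.dft (fun x => (χ x : ℂ)) = 0 := by
    ext k
    have := D.gaussSum_mul (-k)
    rw [h, mul_zero] at this
    rw [ZMod.dft_apply, Pi.zero_apply, ← this]
    refine Finset.sum_congr rfl fun x _ => ?_
    rw [smul_eq_mul, mul_comm, mul_neg]
  have h2 := congrFun ((LinearEquiv.map_eq_zero_iff _).1 h1) 1
  simp at h2

lemma logDeriv_const_mul_etaTwist {C : ℂ} (hC : C ≠ 0) {z : ℂ} (hz : 0 < z.im) :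
    logDeriv (fun w => C * etaTwist χ r w) z = ∑ x, χ x * logDeriv η (z + r x / u) := by
  rw [logDeriv_const_mul _ _ hC]
  unfold etaTwist
  rw [logDeriv_prod (f := fun x w => η (w + r x / u) ^ χ x)
    (fun x _ => zpow_ne_zero _ (eta_translate_ne_zero hz _ _)) fun x _ =>
    (differentiableAt_eta_translate hz _ _).zpow (Or.inl (eta_translate_ne_zero hz _ _))]
  refine Finset.sum_congr rfl fun x _ => ?_
  rw [logDeriv_fun_zpow (differentiableAt_eta_translate hz _ _)]
  congr 1
  simp only [logDeriv_apply, deriv_comp_add_const]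

lemma logDeriv_eta_cpow {t : ℕ} (ht : 0 < t) (a : ℂ) {z : ℂ} (hre : z.re = 0) (hz : 0 < z.im) :
    DifferentiableAt ℂ (fun w => η (t * w) ^ a) z ∧
      logDeriv (fun w => η (t * w) ^ a) z = a * (t * logDeriv η (t * z)) := by
  have him : 0 < ((t : ℂ) * z).im := by
    have : (0 : ℝ) < t := by exact_mod_cast ht
    simp
    positivity
  have hs : η (t * z) ∈ slitPlane := eta_mem_slitPlane (by simp [hre]) him
  have hd : HasDerivAt (fun w => η (t * w)) (deriv η (t * z) * t) z :=
    (differentiableAt_eta_of_mem_upperHalfPlaneSet him).hasDerivAt.comp z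
      (by simpa using (hasDerivAt_id z).const_mul (t : ℂ))
  have h := hd.cpow_const (c := a) hs
  have h0 : η (t * z) ≠ 0 := eta_ne_zero him
  refine ⟨h.differentiableAt, ?_⟩
  rw [logDeriv_apply, h.deriv, logDeriv_apply, Complex.cpow_sub _ _ h0, Complex.cpow_one]
  have : η (t * z) ^ a ≠ 0 := by simp [Complex.cpow_eq_zero_iff, h0]
  field_simp

/-- Comparing the logarithmic derivatives along the imaginary axis, the coefficient of `q ^ m`, for
`m` prime to the level, is a fixed multiple of `σ₁(m)` for an `η`-quotient, but is
`χ m` times a fixed multiple of it for the product of translates. -/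
lemma TwistDatum.not_isEtaQuotient (D : TwistDatum u χ r) {f : ℍ → ℂ} {C : ℂ} (hC : C ≠ 0)
    (hf : ∀ τ : ℍ, f τ = C * etaTwist χ r τ) : ¬ IsEtaQuotient f := by
  rintro ⟨M, hM, c, a, h⟩
  have hc : c ≠ 0 := by
    rintro rfl
    have := h UpperHalfPlane.I
    rw [zero_mul, hf] at this
    exact mul_ne_zero hC (etaTwist_ne_zero UpperHalfPlane.I.im_pos) this
  have htpos : ∀ t ∈ M.divisors, 0 < t := fun t ht => Nat.pos_of_mem_divisors ht
  have hlog : ∀ z : ℂ, z.re = 0 → 0 < z.im → ∑ x, (χ x : ℂ) * logDeriv η (z + r x / u) =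
      ∑ t ∈ M.divisors, a t * (t * logDeriv η (t * z)) := fun z hre hz => by
    rw [← logDeriv_const_mul_etaTwist hC hz]
    have heq : (fun w => C * etaTwist χ r w) =ᶠ[nhds z]
        fun w => c * ∏ t ∈ M.divisors, η (t * w) ^ a t := by
      filter_upwards [isOpen_upperHalfPlaneSet.mem_nhds hz] with w hw
      have := h ⟨w, hw⟩
      rwa [hf] at this
    have him : ∀ t ∈ M.divisors, 0 < ((t : ℂ) * z).im := fun t ht => by
      have : (0 : ℝ) < t := by exact_mod_cast htpos t ht
      simp
      positivity
    rw [(logDeriv_congr_nhds heq).self_of_nhds, logDeriv_const_mul _ _ hc, logDeriv_prod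
      (fun t ht => by simp [Complex.cpow_eq_zero_iff, eta_ne_zero (him t ht)])
      fun t ht => (logDeriv_eta_cpow (htpos t ht) _ hre hz).1]
    exact Finset.sum_congr rfl fun t ht => (logDeriv_eta_cpow (htpos t ht) _ hre hz).2
  set s : ℕ → ℂ := fun n => if n = 0 then 1 else -24 * ArithmeticFunction.sigma 1 n with hs
  set g : ℂ := ∑ x, (χ x : ℂ) * ZMod.stdAddChar x with hg
  have hcoeff : ∀ m : ℕ, s m * (χ (m : ZMod u) * g) -
      ∑ t ∈ M.divisors, (if t ∣ m then a t * t * s (m / t) else 0) = 0 := by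
    refine coeff_eq_zero_of_hasSum_zero fun q hq0 hq1 => ?_
    obtain ⟨z, hre, hz, hqz⟩ : ∃ z : ℂ, z.re = 0 ∧ 0 < z.im ∧
        exp (2 * Real.pi * Complex.I * z) = q := by
      refine ⟨(-Real.log q / (2 * Real.pi) : ℝ) * Complex.I,
        by rw [Complex.re_ofReal_mul, Complex.I_re, mul_zero], ?_, ?_⟩
      · have := Real.log_neg hq0 hq1
        have := Real.pi_pos
        simp only [Complex.im_ofReal_mul, Complex.I_im, mul_one]
        exact div_pos (by linarith) (by positivity)
      · have : 2 * Real.pi * Complex.I *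
            ((-Real.log q / (2 * Real.pi) : ℝ) * Complex.I) = (Real.log q : ℝ) := by
          have hpi : (Real.pi : ℂ) ≠ 0 := by exact_mod_cast Real.pi_ne_zero
          push_cast
          field_simp
          rw [Complex.I_sq]
          ring
        rw [this, ← Complex.ofReal_exp, Real.exp_log hq0]
    have h1 : HasSum (fun m : ℕ => s m * (χ (m : ZMod u) * g) * (q : ℂ) ^ m)
        (∑ x, (χ x : ℂ) * (12 / (Real.pi * Complex.I) * logDeriv η (z + r x / u))) := by
      refine (hasSum_sum (s := Finset.univ) fun x _ =>
        (hasSum_logDeriv_eta (im_add_div_pos hz (r x) u)).mul_left (χ x : ℂ)).congr_fun fun m => ?_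
      simp_rw [exp_translate_pow D, hqz]
      rw [hg, ← D.gaussSum_mul, Finset.mul_sum, Finset.sum_mul]
      exact Finset.sum_congr rfl fun x _ => by ring
    have h2 : HasSum (fun m : ℕ => (∑ t ∈ M.divisors, (if t ∣ m then a t * t * s (m / t) else 0)) *
        (q : ℂ) ^ m) (∑ t ∈ M.divisors, a t * t *
          (12 / (Real.pi * Complex.I) * logDeriv η (t * z))) := by
      simp_rw [Finset.sum_mul]
      refine hasSum_sum fun t ht => ?_
      have ht0 := htpos t ht
      have him : 0 < ((t : ℂ) * z).im := by
        have : (0 : ℝ) < t := by exact_mod_cast ht0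
        simp
        positivity
      have hinj : Function.Injective fun n : ℕ => t * n := mul_right_injective₀ ht0.ne'
      rw [← hinj.hasSum_iff fun m hm => ?_]
      · refine ((hasSum_logDeriv_eta him).mul_left (a t * t)).congr_fun fun n => ?_
        have : exp (2 * Real.pi * Complex.I * (t * z)) = (q : ℂ) ^ t := by
          rw [← hqz, ← Complex.exp_nat_mul]
          ring_nf
        simp only [Function.comp_apply, dvd_mul_right, if_true, Nat.mul_div_cancel_left _ ht0, this]
        rw [← pow_mul]
        ring
      · rw [if_neg fun hdvd => hm ?_, zero_mul]
        obtain ⟨n, rfl⟩ := hdvd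
        exact ⟨n, rfl⟩
    have h3 := h1.sub h2
    have h4 : ∑ x, (χ x : ℂ) * (12 / (Real.pi * Complex.I) * logDeriv η (z + r x / u)) -
        ∑ t ∈ M.divisors, a t * t * (12 / (Real.pi * Complex.I) * logDeriv η (t * z)) = 0 := by
      rw [sub_eq_zero]
      have := congrArg (12 / (Real.pi * Complex.I) * ·) (hlog z hre hz)
      simp only [Finset.mul_sum] at this
      convert! this using 2 <;> ring_nf
    rw [h4] at h3
    exact h3.congr_fun fun m => by ring
  have hkey : ∀ m : ℕ, m ≠ 0 → m.Coprime M → χ (m : ZMod u) * g = a 1 := fun m hm hcop => by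
    have h1 := hcoeff m
    rw [Finset.sum_eq_single_of_mem 1 (Nat.one_mem_divisors.2 hM.ne') fun t ht ht1 => ?_] at h1
    · have hs0 : s m ≠ 0 := by
        have : ArithmeticFunction.sigma 1 m ≠ 0 := by
          rw [Ne, ArithmeticFunction.sigma_eq_zero]
          exact hm
        simp [hs, hm, this]
      simp only [one_dvd, if_true, Nat.cast_one, mul_one, Nat.div_one] at h1
      refine mul_left_cancel₀ hs0 ?_
      linear_combination h1
    · exact if_neg fun hdvd => ht1
        (Nat.eq_one_of_dvd_coprimes hcop hdvd (Nat.dvd_of_mem_divisors ht))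
  obtain ⟨b, hb⟩ := D.exists_neg
  have hunit : IsUnit b := by
    by_contra hb'
    rw [MulChar.map_nonunit _ hb'] at hb
    norm_num at hb
  obtain ⟨p, hpM, hp, hpb⟩ := Nat.forall_exists_prime_gt_and_eq_mod hunit M
  have h1 := hkey 1 one_ne_zero (Nat.coprime_one_left M)
  have h2 := hkey p hp.ne_zero
    ((Nat.Prime.coprime_iff_not_dvd hp).2 fun hdvd => (Nat.le_of_dvd hM hdvd).not_gt hpM)
  rw [hpb, hb] at h2
  refine D.gaussSum_ne_zero ?_
  push_cast at h1 h2
  rw [map_one] at h1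
  push_cast at h1
  linear_combination (h1 - h2) / 2


/-! ### The characters modulo `3`, `4` and `5` -/

/-- For odd `u` and even representatives `r`, the matrices relating the translates are congruent
modulo `2` to the given one. -/
lemma etaSign_conj_of_odd {u : ℕ} (hu : (u : ZMod 2) = 1) {r : ZMod u → ℤ}
    (hr : ∀ x, (r x : ZMod 2) = 0) (a b c d : ℤ) (x : ZMod u) (k : ℤ)
    (hk : u * k = r x * d - r (x * d ^ 2) * a) :
    etaSign (a + r x * u * c) (b + k - r x * r (x * d ^ 2) * c) (u ^ 2 * c)
      (d - r (x * d ^ 2) * u * c) = etaSign a b (u ^ 2 * c) d := by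
  have hk2 : (k : ZMod 2) = 0 := by
    have := congrArg (Int.cast : ℤ → ZMod 2) hk
    simpa [hu, hr] using this
  unfold etaSign
  push_cast
  simp [hr, hk2]

/-- The representatives `4, 2` are even, so that the matrices in `sign` stay the same modulo `2`. -/
lemma twistDatum_three :
    TwistDatum 3 (quadraticChar (ZMod 3)) (fun x => if x = 1 then 4 else if x = 2 then 2 else 0) where
  one_lt := by norm_num
  rep := by decide
  fiber := by decide
  exists_neg := ⟨2, by decide⟩
  sign a b c d _ := ⟨_, fun x k _ => etaSign_conj_of_odd (u := 3)
    (r := fun x => if x = 1 then 4 else if x = 2 then 2 else 0) rfl (by decide) a b c d x k⟩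

/-- As for `3`, with the even representatives `6, 2, 8, 4` of the units modulo `5`. -/
lemma twistDatum_five :
    TwistDatum 5 (quadraticChar (ZMod 5)) (fun x => if x.val % 2 = 0 then x.val else x.val + 5) where
  one_lt := by norm_num
  rep := by decide
  fiber := by decide
  exists_neg := ⟨2, by decide⟩
  sign a b c d _ := ⟨_, fun x k _ => etaSign_conj_of_odd (u := 5)
    (r := fun x => if x.val % 2 = 0 then x.val else x.val + 5) rfl (by decide) a b c d x k⟩

/-- Modulo `2`, only the upper right entry of the matrices in `sign` could depend on `x`, and `x = 1`
and `x = 3` give the same parity, because `a ≡ d` modulo `4`. -/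
lemma twistDatum_four : TwistDatum 4 ZMod.χ₄ (fun x => x.val) where
  one_lt := by norm_num
  rep := by decide
  fiber := by decide
  exists_neg := ⟨3, by decide⟩
  sign a b c d h := by
    have had : (a : ZMod 4) * d = 1 := by
      have := congrArg (Int.cast : ℤ → ZMod 4) h
      push_cast at this
      rwa [show (16 : ZMod 4) = 0 from rfl, zero_mul, mul_zero, sub_zero] at this
    have hsq : ∀ x : ZMod 4, x * (d : ZMod 4) ^ 2 = x := by
      generalize (a : ZMod 4) = a' at had
      generalize (d : ZMod 4) = d' at had ⊢
      revert a' d'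
      decide
    have hdvd : (4 : ℤ) ∣ d - a := by
      refine (ZMod.intCast_zmod_eq_zero_iff_dvd (d - a) 4).1 ?_
      push_cast
      generalize (a : ZMod 4) = a' at had
      generalize (d : ZMod 4) = d' at had ⊢
      revert a' d'
      decide
    obtain ⟨e, he⟩ := hdvd
    refine ⟨etaSign a (b + e - c) (4 ^ 2 * c) d, fun x k hx hk => ?_⟩
    rw [hsq] at hk ⊢
    have hodd : ∀ x : ZMod 4, ZMod.χ₄ x ≠ 0 → ((x.val : ℤ) : ZMod 2) = 1 := by decide
    have hj := hodd x hx
    generalize (x.val : ℤ) = j at *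
    have hke : k = j * e := by
      push_cast at hk
      have : 4 * k = 4 * (j * e) := by linear_combination hk + j * he
      omega
    have h4 : (4 : ZMod 2) = 0 := rfl
    subst hke
    unfold etaSign
    push_cast
    simp [hj, h4]

/-- A nontrivial character of prime modulus is primitive. -/
lemma conductor_legendreChar {p : ℕ} [Fact p.Prime] (hp : p ≠ 2) :
    (legendreChar p).conductor = p := by
  have hne : legendreChar p ≠ 1 := fun h => by
    have hp' : ringChar (ZMod p) ≠ 2 := by rwa [ZMod.ringChar_zmod_n]
    obtain ⟨a, ha⟩ := quadraticChar_exists_neg_one hp'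
    have ha0 : IsUnit a := by
      by_contra hb
      rw [MulChar.map_nonunit _ hb] at ha
      norm_num at ha
    have h1 := congrArg (fun X : DirichletCharacter ℂ p => X a) h
    simp only [legendreChar, MulChar.ringHomComp_apply, ha, MulChar.one_apply ha0] at h1
    norm_num at h1
  rcases (Nat.dvd_prime (Fact.out : p.Prime)).1 (legendreChar p).conductor_dvd_level with h | h
  · exact absurd (DirichletCharacter.eq_one_iff_conductor_eq_one.2 h) hne
  · exact h

lemma conductor_psiFour : psiFour.conductor = 4 := by
  have hval : psiFour 3 = -1 := by
    have : ZMod.χ₄ 3 = -1 := by decide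
    simp [psiFour, MulChar.ringHomComp_apply, this]
  have h0 : psiFour.conductor ∣ 2 ^ 2 := psiFour.conductor_dvd_level
  obtain ⟨k, hk, hk'⟩ := (Nat.dvd_prime_pow Nat.prime_two).1 h0
  by_contra hne
  have h2 : psiFour.conductor ∣ 2 := by
    rw [hk'] at hne ⊢
    interval_cases k <;> simp_all
  -- a character that factors through `ZMod 2` is trivial on all units
  have hfac := DirichletCharacter.FactorsThrough.mono _ psiFour.factorsThrough_conductor h2
    (by norm_num : 2 ∣ 4)
  have h3 := (DirichletCharacter.factorsThrough_iff_ker_unitsMap (by norm_num : 2 ∣ 4)).1 hfac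
  have hu : (ZMod.unitOfCoprime 3 (by norm_num) : (ZMod 4)ˣ) ∈
      (ZMod.unitsMap (by norm_num : 2 ∣ 4)).ker := by
    rw [MonoidHom.mem_ker]
    exact Subsingleton.elim _ _
  have h4 := congrArg Units.val (MonoidHom.mem_ker.1 (h3 hu))
  rw [MulChar.coe_toUnitHom, ZMod.coe_unitOfCoprime] at h4
  push_cast at h4
  rw [hval] at h4
  norm_num at h4

lemma TwistDatum.genEta_properties (D : TwistDatum u χ r) {X : DirichletCharacter ℂ u}
    (hX : X = χ.ringHomComp (Int.castRingHom ℂ)) (hcond : X.conductor = u) :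
    (∀ τ : ℍ, Multipliable fun n : ℕ => genEtaFactor X (n + 1) τ) ∧
      IsGMFWithTwelfthRootMultiplier (Gamma0 (u ^ 2)) (genEta X) ∧
      HasCuspidalDivisor (genEta X) ∧ ¬ IsEtaQuotient (genEta X) ∧
      IsModularFunction (Gamma0 (u ^ 2)) (fun τ => genEta X τ ^ 12) ∧
      HasCuspidalDivisor (fun τ => genEta X τ ^ 12) := by
  obtain ⟨C, hC, h⟩ := D.exists_genEta_eq hX hcond
  exact ⟨fun τ => (D.hasProd_genEtaFactor hX hcond τ).multipliable, D.isGMF hC h,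
    hasCuspidalDivisor hC h, D.not_isEtaQuotient hC h, D.isModularFunction_pow h,
    hasCuspidalDivisor_pow hC h⟩

end GenEta

theorem theorem2 :
    -- the character `(· / 3)`, on `Γ₀(9)`
    ((∀ τ : UpperHalfPlane,
        Multipliable fun n : ℕ => GenEta.genEtaFactor (GenEta.legendreChar 3) (n + 1) τ) ∧
      GenEta.IsGMFWithTwelfthRootMultiplier (CongruenceSubgroup.Gamma0 9)
        (GenEta.genEta (GenEta.legendreChar 3)) ∧
      GenEta.HasCuspidalDivisor (GenEta.genEta (GenEta.legendreChar 3)) ∧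
      ¬ GenEta.IsEtaQuotient (GenEta.genEta (GenEta.legendreChar 3)) ∧
      GenEta.IsModularFunction (CongruenceSubgroup.Gamma0 9)
        (fun τ => GenEta.genEta (GenEta.legendreChar 3) τ ^ 12) ∧
      GenEta.HasCuspidalDivisor (fun τ => GenEta.genEta (GenEta.legendreChar 3) τ ^ 12)) ∧
    -- the nontrivial character modulo `4`, on `Γ₀(16)`
    ((∀ τ : UpperHalfPlane,
        Multipliable fun n : ℕ => GenEta.genEtaFactor GenEta.psiFour (n + 1) τ) ∧
      GenEta.IsGMFWithTwelfthRootMultiplier (CongruenceSubgroup.Gamma0 16)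
        (GenEta.genEta GenEta.psiFour) ∧
      GenEta.HasCuspidalDivisor (GenEta.genEta GenEta.psiFour) ∧
      ¬ GenEta.IsEtaQuotient (GenEta.genEta GenEta.psiFour) ∧
      GenEta.IsModularFunction (CongruenceSubgroup.Gamma0 16)
        (fun τ => GenEta.genEta GenEta.psiFour τ ^ 12) ∧
      GenEta.HasCuspidalDivisor (fun τ => GenEta.genEta GenEta.psiFour τ ^ 12)) ∧
    -- the character `(· / 5)`, on `Γ₀(25)`
    ((∀ τ : UpperHalfPlane,
        Multipliable fun n : ℕ => GenEta.genEtaFactor (GenEta.legendreChar 5) (n + 1) τ) ∧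
      GenEta.IsGMFWithTwelfthRootMultiplier (CongruenceSubgroup.Gamma0 25)
        (GenEta.genEta (GenEta.legendreChar 5)) ∧
      GenEta.HasCuspidalDivisor (GenEta.genEta (GenEta.legendreChar 5)) ∧
      ¬ GenEta.IsEtaQuotient (GenEta.genEta (GenEta.legendreChar 5)) ∧
      GenEta.IsModularFunction (CongruenceSubgroup.Gamma0 25)
        (fun τ => GenEta.genEta (GenEta.legendreChar 5) τ ^ 12) ∧
      GenEta.HasCuspidalDivisor (fun τ => GenEta.genEta (GenEta.legendreChar 5) τ ^ 12)) := by
  -- `Γ₀(3²)` and `Γ₀(9)` agree by definitional unfolding, and likewise for `4` and `5`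
  exact ⟨GenEta.twistDatum_three.genEta_properties rfl
      (GenEta.conductor_legendreChar (by norm_num)),
    GenEta.twistDatum_four.genEta_properties rfl GenEta.conductor_psiFour,
    GenEta.twistDatum_five.genEta_properties rfl
      (GenEta.conductor_legendreChar (by norm_num))⟩
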